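/- **Diversity constant for naturally bounded contexts.** There is an absolute constant $c>0$ such that the following holds. *Setting.* Let $d,K\ge 1$, and consider the linear contextual bandit with $K$ arms, whose round $s\ge 1$ has contexts $\mathbf X(s)=(X_1(s),\dots,X_K(s))\in(\mathbb R^d)^K$ and rewards $Y_i(s)=X_i(s)^\top\theta^\star+\eta_i(s)$ with $\theta^\star \in \mathbb R^d$ (contexts $\mathbf X(s)$ and noise $\eta(s)$ being random vectors on a common probability space). For $\theta\in\mathbb R^d$ let $a_\theta(\mathbf x)\in\arg\max_{i}x_i^\top\theta$, where ties are broken by any rule that is jointly measurable in $(\theta,\mathbf x)$; for $\theta=0$, where all arms tie, the rule selects an arm that does not depend on $\mathbf x$. The greedy algorithm with initial parameter $\theta_0\in\mathbb R^d$ pulls in round $s$ the arm $a(s)=a_{\vartheta}(\mathbf X(s))$, where, with $\Sigma(s-1)=\sum_{r<s}X_{a(r)}(r)X_{a(r)}(r)^\top$ and $b(s-1)=\sum_{r<s}Y_{a(r)}(r)X_{a(r)}(r)$, one takes $\vartheta=\theta_0$ if $\lambda_{\min}(\Sigma(s-1))=0$, and $\vartheta=\Sigma(s-1)^{-1}b(s-1)$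 otherwise. Let $\mathcal H_{s}$ be the sigma-algebra generated by $a(r)$, $X_{a(r)}(r)$, $Y_{a(r)}(r)$, $1\le r\le s$. The diversity constant of $\mathbf X(t)$ is $$\lambda_\star(t):=\inf_{\|\theta\|_2=1}\lambda_{\min}\Big(\mathbb E\big[X_{a_\theta(\mathbf X(t))}(t)\,X_{a_\theta(\mathbf X(t))}(t)^\top\big]\Big).$$ *Hypotheses.* Fix a round $t\ge1$, and let $R>0$ and $\mathbb B_R=\{x\in\mathbb R^d:\|x\|_2\le R\}$. Suppose that $\mathbf X(t)\in(\mathbb B_R)^K$ almost surely and that $\mathbf X(t)$ has a density $f$ with respect to Lebesgue measure on $\mathbb R^{dK}$ such that: 1. (local anti-concentration on $(\mathbb B_R)^K$ with a constant function $\mathcal L(R)$) at every interior point $x$ of $(\mathbb B_R)^K$, $f$ is positive and differentiable and $\|\nabla\log f(x)\|_\infty\le\mathcal L(R)$; 2. (concentration condition) $0<c_\star<1$, $0<p_\star<1$, and $\mathbb P\big[\max_{i}X_i(t)^\top\eta\le c_\star R\big]\ge p_\star$ for every $\eta\in\mathbb R^d$ with $\|\eta\|_2=1$. *Conclusion.*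 Then $$\lambda_\star(t)\;\ge\;\underline\lambda:=c\,\frac{p_\star}{d}\cdot\frac{1}{\Big(\mathcal L(R)+\frac{1}{R(1-c_\star)}\Big)^2}.$$ If moreover $\mathbf X(t)$ is independent of $\mathcal H_{t-1}$, then almost surely $$\mathbb E\big[X_{a(t)}(t)X_{a(t)}(t)^\top\mid\mathcal H_{t-1}\big]\succeq\underline\lambda\, I_d .$$ -/

import Mathlib

open MeasureTheory ProbabilityTheory Matrix

namespace LACBandit

/-- A context set: one vector of `ℝ^d` (Euclidean norm) for each of the `K` arms. As a measure
space this is `ℝ^{dK}` with Lebesgue measure. -/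
abbrev Contexts (K d : ℕ) : Type := Fin K → EuclideanSpace ℝ (Fin d)

/-- The sup norm of `x` as a vector of `ℝ^{dK}` (the largest absolute value of a coordinate). -/
noncomputable def supNorm {K d : ℕ} (x : Contexts K d) : ℝ :=
  ‖(fun p : Fin K × Fin d => x p.1 p.2)‖

/-- The partial derivative of `g` at `x` in the `j`-th coordinate of the `i`-th arm. -/
noncomputable def partialDeriv {K d : ℕ} (g : Contexts K d → ℝ) (x : Contexts K d)
    (i : Fin K) (j : Fin d) : ℝ :=
  fderiv ℝ g x (Pi.single i (EuclideanSpace.single j 1))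

/-- Local anti-concentration of the density `f` on the domain `D`, with LAC function the
polynomial `ℓ`, non-decreasing on `[0, ∞)`: on `D` the function `log f` is defined (`f > 0`) and
differentiable, and `‖∇ log f (x)‖_∞ ≤ ℓ (‖x‖_∞)`. -/
structure SatisfiesLAC {K d : ℕ} (D : Set (Contexts K d)) (f : Contexts K d → ℝ)
    (ℓ : Polynomial ℝ) : Prop where
  mono : MonotoneOn (fun r : ℝ => ℓ.eval r) (Set.Ici 0)
  pos : ∀ x ∈ D, 0 < f x
  diff : ∀ x ∈ D, DifferentiableAt ℝ f x
  bound : ∀ x ∈ D, ∀ i j,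
    |partialDeriv (fun y => Real.log (f y)) x i j| ≤ ℓ.eval (supNorm x)

/-- `f` is a probability density, with respect to Lebesgue measure on `ℝ^{dK}`, of the random
vector `X`. -/
structure IsDensityOf {Ω : Type*} [MeasurableSpace Ω] {K d : ℕ} (P : Measure Ω)
    (X : Ω → Contexts K d) (f : Contexts K d → ℝ) : Prop where
  measurable : Measurable f
  nonneg : ∀ x, 0 ≤ f x
  law : P.map X = volume.withDensity (fun x => ENNReal.ofReal (f x))

/-- The interior of `(B_R)^K`. Its complement in `(B_R)^K` is a null set, on which a density
that vanishes outside `(B_R)^K` is in general not differentiable. -/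
def openBallProduct (K d : ℕ) (R : ℝ) : Set (Contexts K d) := {x | ∀ i, ‖x i‖ < R}

/-- The concentration condition with parameters `cs` and `ps` for contexts in the ball of
radius `R`. -/
structure HasConcentration {Ω : Type*} [MeasurableSpace Ω] {K d : ℕ} (P : Measure Ω)
    (X : Ω → Contexts K d) (R cs ps : ℝ) : Prop where
  cs_pos : 0 < cs
  cs_lt_one : cs < 1
  ps_pos : 0 < ps
  ps_lt_one : ps < 1
  prob : ∀ η : EuclideanSpace ℝ (Fin d), ‖η‖ = 1 →
    ps ≤ P.real {ω | ∀ i, inner ℝ (X ω i) η ≤ cs * R}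

/-- The smallest eigenvalue of a (symmetric) real matrix. -/
noncomputable def minEigenvalue {d : ℕ} (A : Matrix (Fin d) (Fin d) ℝ) : ℝ :=
  sInf (spectrum ℝ A)

/-- `sel θ x` is a choice of `argmax_i ⟨x_i, θ⟩`, ties being broken in an arbitrary measurable
way. For `θ = 0` all arms tie for every `x`; there the choice is a fixed arm. -/
structure IsGreedyRule {K d : ℕ}
    (sel : EuclideanSpace ℝ (Fin d) → Contexts K d → Fin K) : Prop where
  measurable : Measurable (fun p : EuclideanSpace ℝ (Fin d) × Contexts K d => sel p.1 p.2)
  isMax : ∀ (θ : EuclideanSpace ℝ (Fin d)) (x : Contexts K d) (j : Fin K),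
    inner ℝ (x j) θ ≤ inner ℝ (x (sel θ x)) θ
  zero : ∃ i, ∀ x, sel 0 x = i

/-- `E[X_a X_aᵀ]`, for the arm `a` selected greedily with respect to `θ`. -/
noncomputable def selectedSecondMoment {Ω : Type*} [MeasurableSpace Ω] {K d : ℕ}
    (P : Measure Ω) (X : Ω → Contexts K d)
    (sel : EuclideanSpace ℝ (Fin d) → Contexts K d → Fin K) (θ : EuclideanSpace ℝ (Fin d)) :
    Matrix (Fin d) (Fin d) ℝ :=
  Matrix.of fun j k => ∫ ω, X ω (sel θ (X ω)) j * X ω (sel θ (X ω)) k ∂P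

/-- The diversity constant of the contexts `X`: the infimum over unit vectors `θ` of the
smallest eigenvalue of `E[X_a X_aᵀ]`, where `a = argmax_i ⟨X_i, θ⟩`. -/
noncomputable def diversityConstant {Ω : Type*} [MeasurableSpace Ω] {K d : ℕ}
    (P : Measure Ω) (X : Ω → Contexts K d)
    (sel : EuclideanSpace ℝ (Fin d) → Contexts K d → Fin K) : ℝ :=
  ⨅ θ : Metric.sphere (0 : EuclideanSpace ℝ (Fin d)) 1,
    minEigenvalue (selectedSecondMoment P X sel θ)

/-- The parameter used by the greedy algorithm, given the Gram matrix `S.1 = ∑ x xᵀ` and the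
vector `S.2 = ∑ y x` of the past rounds: the initial parameter `θ₀` as long as the Gram matrix
is singular, and then the ordinary least squares estimator. -/
noncomputable def linGreedyParam {d : ℕ} (θ₀ : EuclideanSpace ℝ (Fin d))
    (S : Matrix (Fin d) (Fin d) ℝ × EuclideanSpace ℝ (Fin d)) : EuclideanSpace ℝ (Fin d) :=
  if minEigenvalue S.1 = 0 then θ₀ else WithLp.toLp 2 (S.1⁻¹ *ᵥ S.2.ofLp)

/-- The pair `(Σ(t), b(t))` of the greedy algorithm after rounds `1, …, t`, on a realisation of
the contexts `x s i` and of the noise `η s i` (arm `i` in round `s ≥ 1`); the reward of the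
pulled arm `a` in round `s` is `⟨x s a, θs⟩ + η s a`. The values at `s = 0` are not used. -/
noncomputable def linGreedyState {K d : ℕ}
    (sel : EuclideanSpace ℝ (Fin d) → Contexts K d → Fin K) (θs θ₀ : EuclideanSpace ℝ (Fin d))
    (x : ℕ → Contexts K d) (η : ℕ → Fin K → ℝ) :
    ℕ → Matrix (Fin d) (Fin d) ℝ × EuclideanSpace ℝ (Fin d)
  | 0 => (0, 0)
  | t + 1 =>
    let S := linGreedyState sel θs θ₀ x η t
    let a := sel (linGreedyParam θ₀ S) (x (t + 1))
    (S.1 + Matrix.vecMulVec (x (t + 1) a).ofLp (x (t + 1) a).ofLp,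
      S.2 + (inner ℝ (x (t + 1) a) θs + η (t + 1) a) • x (t + 1) a)

/-- The arm `a(t)` pulled by the greedy algorithm in round `t ≥ 1`. -/
noncomputable def linGreedyArm {K d : ℕ}
    (sel : EuclideanSpace ℝ (Fin d) → Contexts K d → Fin K) (θs θ₀ : EuclideanSpace ℝ (Fin d))
    (x : ℕ → Contexts K d) (η : ℕ → Fin K → ℝ) (t : ℕ) : Fin K :=
  sel (linGreedyParam θ₀ (linGreedyState sel θs θ₀ x η (t - 1))) (x t)

section Run

variable {Ω : Type*} {K d : ℕ} (sel : EuclideanSpace ℝ (Fin d) → Contexts K d → Fin K)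
  (θs θ₀ : EuclideanSpace ℝ (Fin d)) (X : ℕ → Ω → Contexts K d) (η : ℕ → Ω → Fin K → ℝ)

/-- The random arm `a(t)`. -/
noncomputable def arm (t : ℕ) (ω : Ω) : Fin K :=
  linGreedyArm sel θs θ₀ (fun s => X s ω) (fun s => η s ω) t

/-- The context `X_{a(t)}(t)` of the pulled arm. -/
noncomputable def selectedContext (t : ℕ) (ω : Ω) : EuclideanSpace ℝ (Fin d) :=
  X t ω (arm sel θs θ₀ X η t ω)

/-- The reward `Y_{a(t)}(t)` of the pulled arm. -/
noncomputable def reward (t : ℕ) (ω : Ω) : ℝ :=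
  inner ℝ (selectedContext sel θs θ₀ X η t ω) θs + η t ω (arm sel θs θ₀ X η t ω)

/-- The history `H_t`: the sigma-algebra generated by the pulled arms, their contexts and their
rewards in rounds `1, …, t`. -/
@[reducible]
noncomputable def history (t : ℕ) : MeasurableSpace Ω :=
  ⨆ s ∈ Finset.Icc 1 t,
    MeasurableSpace.comap (arm sel θs θ₀ X η s) inferInstance ⊔
    MeasurableSpace.comap (selectedContext sel θs θ₀ X η s) inferInstance ⊔
    MeasurableSpace.comap (reward sel θs θ₀ X η s) inferInstance

/-- `E[X_{a(t)}(t) X_{a(t)}(t)ᵀ | H_{t-1}]`, entry by entry. -/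
noncomputable def conditionalSecondMoment [MeasurableSpace Ω] (P : Measure Ω) (t : ℕ) (ω : Ω) :
    Matrix (Fin d) (Fin d) ℝ :=
  Matrix.of fun j k =>
    (P[fun ω' => selectedContext sel θs θ₀ X η t ω' j * selectedContext sel θs θ₀ X η t ω' k |
      history sel θs θ₀ X η (t - 1)]) ω

end Run

end LACBandit

/-! Fix `θ`, let `a` be the selected arm, `u` the direction of `θ`, and `v` a unit vector with `⟨v,
u⟩ ≥ 0` (otherwise flip `v`). It suffices that `|⟨X_a, v⟩| ≥ ε` has probability at least `p⋆/3`,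
where `ε` is of order `1/(√d D)` and `D = L + 1/(R(1 - c⋆))`; Markov's inequality then bounds
`E⟨X_a, v⟩²` from below. Consider the bad event `|⟨X_a, v⟩| < ε`, `⟨X_a, u⟩ ≤ c⋆R`. There the
selected vector is contracted slightly towards a multiple of `u` and then translated by `3ε v`. By
`push_in_ball` it stays in the ball, its score along `u` increases, so it remains selected, and its
component along `v` becomes at least `ε`. The contraction ratio is `1 - s` with `s` of order `ε²`,
so the Jacobian `(1 - s)^d` is close to 1 even for `ε` of order `1/√d`; anti-concentration controls
the change of density (`SatisfiesLAC.density_le`). Hence the bad event has at most twice the mass of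
`|⟨X_a, v⟩| ≥ ε` (`withDensity_le_two_mul_of_stable`), and the concentration condition says that the
two together have mass at least `p⋆`. The bound holds for every `θ`, zero included. The parameter
used in round `t` is measurable for the history, so under independence conditioning amounts to
freezing it (`condExp_ae_eq_integral_of_indep`). -/

namespace LACBandit

/-! ### Affine moves of one arm: Jacobian and change of density. -/

/-- Replace the vector of arm `i` by its image under the affine map `y ↦ r • y + w`. -/
def moveArm {K d : ℕ} (i : Fin K) (r : ℝ) (w : EuclideanSpace ℝ (Fin d)) (x : Contexts K d) :
    Contexts K d :=
  Function.update x i (r • x i + w)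

theorem moveArm_injective {K d : ℕ} (i : Fin K) {r : ℝ} (hr : r ≠ 0)
    (w : EuclideanSpace ℝ (Fin d)) : Function.Injective (moveArm i r w) := by
  intro x y h
  funext j
  have hj := congrFun h j
  by_cases hji : j = i
  · subst hji
    simpa [moveArm, hr] using hj
  · simpa [moveArm, hji] using hj

theorem lintegral_image_moveArm {K d : ℕ} (i : Fin K) {r : ℝ} (hr : 0 < r)
    (w : EuclideanSpace ℝ (Fin d)) {B : Set (Contexts K d)} (hB : MeasurableSet B)
    (g : Contexts K d → ENNReal) :
    ∫⁻ x in moveArm i r w '' B, g x = ∫⁻ x in B, ENNReal.ofReal (r ^ d) * g (moveArm i r w x) := by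
  let A : Contexts K d →L[ℝ] Contexts K d := ContinuousLinearMap.pi fun j =>
    ((if j = i then r else 1 : ℝ) • ContinuousLinearMap.id ℝ (EuclideanSpace ℝ (Fin d))) ∘SL
      ContinuousLinearMap.proj j
  have hA : A.det = r ^ d := by
    rw [ContinuousLinearMap.det_pi]
    have : ∀ c : ℝ, (c • ContinuousLinearMap.id ℝ (EuclideanSpace ℝ (Fin d))).det = c ^ d := by
      intro c
      simp [ContinuousLinearMap.det, LinearMap.det_smul]
    simp only [this]
    rw [Finset.prod_eq_single i (by intro j _ hj; simp [hj]) (by simp)]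
    simp
  have hT : moveArm i r w = fun x => A x + Pi.single i w := by
    funext x j
    by_cases hj : j = i
    · subst hj; simp [moveArm, A]
    · simp [moveArm, A, hj]
  have hd : ∀ x ∈ B, HasFDerivWithinAt (moveArm i r w) A B x := by
    intro x _
    rw [hT]
    exact (A.hasFDerivAt.add_const _).hasFDerivWithinAt
  rw [lintegral_image_eq_lintegral_abs_det_fderiv_mul volume hB hd
    (moveArm_injective i hr.ne' w).injOn, hA, abs_of_pos (pow_pos hr d)]

theorem sum_abs_le_sqrt_mul_norm {d : ℕ} (w : EuclideanSpace ℝ (Fin d)) :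
    ∑ j, |w j| ≤ √d * ‖w‖ := by
  have h := Finset.sum_mul_sq_le_sq_mul_sq Finset.univ (fun _ : Fin d => (1 : ℝ)) (fun j => |w j|)
  simp only [one_mul, one_pow, Finset.sum_const, Finset.card_univ, Fintype.card_fin, nsmul_eq_mul,
    mul_one, sq_abs] at h
  rw [← EuclideanSpace.real_norm_sq_eq] at h
  refine abs_le_of_sq_le_sq' ?_ (by positivity) |>.2
  rw [mul_pow, Real.sq_sqrt (Nat.cast_nonneg d)]
  exact h

theorem openBallProduct_eq_pi (K d : ℕ) (R : ℝ) :
    openBallProduct K d R = Set.pi Set.univ fun _ => Metric.ball 0 R := by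
  ext x; simp [openBallProduct]

/-- Integrate the gradient of `log f` along the segment, which stays in the convex domain. Only one
arm moves, so pairing the sup-norm bound with the ℓ¹ norm costs `√d` and not `√(dK)`. The last step
is `exp (-t) ≥ 1 - t`. -/
theorem SatisfiesLAC.density_le {K d : ℕ} {R L : ℝ} {f : Contexts K d → ℝ}
    (hf : SatisfiesLAC (openBallProduct K d R) f (Polynomial.C L)) {x : Contexts K d} (i : Fin K)
    (w : EuclideanSpace ℝ (Fin d)) (hx : x ∈ openBallProduct K d R)
    (hxw : x + Pi.single i w ∈ openBallProduct K d R) :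
    (1 - L * (√d * ‖w‖)) * f x ≤ f (x + Pi.single i w) := by
  have hconv : Convex ℝ (openBallProduct K d R) := by
    rw [openBallProduct_eq_pi]
    exact convex_pi fun _ _ => convex_ball _ _
  set h : Contexts K d := Pi.single i w with hh
  have hseg : ∀ τ ∈ Set.Icc (0 : ℝ) 1, x + τ • h ∈ openBallProduct K d R := by
    intro τ hτ
    have := hconv.add_smul_sub_mem hx hxw hτ
    simpa using this
  have hh_sum : h = ∑ j, w j • (Pi.single i (EuclideanSpace.single j 1) : Contexts K d) := by
    funext k
    by_cases hk : k = i
    · subst hk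
      ext l
      simp [hh, Finset.sum_apply, Finset.sum_ite_eq, Pi.single_apply]
    · simp [hh, hk, Finset.sum_apply]
  -- The sign of `L` is read off from the bound on one partial derivative, which requires a
  -- coordinate to exist.
  have hL : 0 ≤ L ∨ d = 0 := by
    rcases Nat.eq_zero_or_pos d with h0 | h0
    · exact Or.inr h0
    · have := hf.bound x hx i ⟨0, h0⟩
      rw [Polynomial.eval_C] at this
      exact Or.inl ((abs_nonneg _).trans this)
  have hbound : ∀ y ∈ openBallProduct K d R,
      ‖fderiv ℝ (fun y => Real.log (f y)) y h‖ ≤ L * (√d * ‖w‖) := by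
    intro y hy
    rcases hL with hL | rfl
    · rw [hh_sum, map_sum]
      refine (norm_sum_le _ _).trans ?_
      calc _ ≤ ∑ j, L * |w j| := by
            refine Finset.sum_le_sum fun j _ => ?_
            rw [map_smul, norm_smul, mul_comm, Real.norm_eq_abs, Real.norm_eq_abs]
            refine mul_le_mul_of_nonneg_right ?_ (abs_nonneg _)
            have := hf.bound y hy i j
            rwa [Polynomial.eval_C] at this
        _ = L * ∑ j, |w j| := by rw [Finset.mul_sum]
        _ ≤ _ := mul_le_mul_of_nonneg_left (sum_abs_le_sqrt_mul_norm w) hL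
    · have : h = 0 := Subsingleton.elim _ _
      simp [this]
  have hmv := norm_image_sub_le_of_norm_deriv_le_segment_01'
    (f := fun τ : ℝ => Real.log (f (x + τ • h)))
    (f' := fun τ => fderiv ℝ (fun y => Real.log (f y)) (x + τ • h) h) (C := L * (√d * ‖w‖))
    (by
      intro τ hτ
      have hy := hseg τ hτ
      have hd : DifferentiableAt ℝ (fun y => Real.log (f y)) (x + τ • h) :=
        (hf.diff _ hy).log (hf.pos _ hy).ne'
      have hline : HasDerivAt (fun τ : ℝ => x + τ • h) h τ := by
        simpa using ((hasDerivAt_id τ).smul_const h).const_add x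
      exact (hd.hasFDerivAt.comp_hasDerivAt τ hline).hasDerivWithinAt)
    (fun τ hτ => hbound _ (hseg τ ⟨hτ.1, hτ.2.le⟩))
  simp only [one_smul, zero_smul, add_zero] at hmv
  have h1 := hf.pos x hx
  have h2 := hf.pos _ hxw
  have h3 : -(L * (√d * ‖w‖)) ≤ Real.log (f (x + h)) - Real.log (f x) :=
    (abs_le.1 hmv).1
  have h4 : 1 - L * (√d * ‖w‖) ≤ f (x + h) / f x := by
    calc 1 - L * (√d * ‖w‖) ≤ Real.exp (-(L * (√d * ‖w‖))) := by
          have := Real.add_one_le_exp (-(L * (√d * ‖w‖))); linarith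
      _ ≤ Real.exp (Real.log (f (x + h)) - Real.log (f x)) := Real.exp_le_exp.2 h3
      _ = _ := by rw [Real.exp_sub, Real.exp_log h2, Real.exp_log h1]
  rwa [le_div_iff₀ h1] at h4

/-! ### Geometry of the push, and transfer of mass. -/

/-- Pull `x` towards the direction `u`, then push it in the direction `v`: the result stays in
the ball, does not lose in the direction `u`, and is not close to the hyperplane `v^⊥`. -/
theorem push_in_ball {E : Type*} [NormedAddCommGroup E] [InnerProductSpace ℝ E]
    {u v x : E} {R q s ε : ℝ} (hu : ‖u‖ = 1) (hv : ‖v‖ = 1) (huv : 0 ≤ inner ℝ v u)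
    (hR : 0 < R) (hq0 : 0 < q) (hq1 : q < 1) (hs0 : 0 < s) (hs1 : s ≤ 1) (hε : 0 < ε)
    (hsR : s * R ≤ ε) (hsε : s * q * R ^ 2 = 50 * ε ^ 2)
    (hx : ‖x‖ ≤ R) (hxu : inner ℝ x u ≤ (1 - q) * R) (hxv : |inner ℝ x v| < ε) :
    let w := (s * (1 - q / 2) * R) • u + (3 * ε) • v
    ‖(1 - s) • x + w‖ < R ∧ inner ℝ x u < inner ℝ ((1 - s) • x + w) u ∧
      ε ≤ inner ℝ ((1 - s) • x + w) v ∧ ‖(1 - s) • x + w - x‖ ≤ 5 * ε := by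
  intro w
  have huu : inner ℝ u u = (1 : ℝ) := by rw [real_inner_self_eq_norm_sq, hu]; norm_num
  have hvv : inner ℝ v v = (1 : ℝ) := by rw [real_inner_self_eq_norm_sq, hv]; norm_num
  have huv1 : inner ℝ u v ≤ (1 : ℝ) := by
    have := real_inner_le_norm u v
    rwa [hu, hv, one_mul] at this
  have huv' : 0 ≤ inner ℝ u v := by rwa [real_inner_comm]
  have hxv' := abs_lt.1 hxv
  have hb0 : 0 ≤ s * (1 - q / 2) * R := by
    have : 0 < 1 - q / 2 := by linarith
    positivity
  have hb1 : s * (1 - q / 2) * R ≤ ε := by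
    have : s * R * (q / 2) ≥ 0 := by positivity
    nlinarith
  set z := (1 - s) • x + (s * (1 - q / 2) * R) • u with hz
  have hy : (1 - s) • x + w = z + (3 * ε) • v := by simp only [w, hz, add_assoc]
  have hzn : ‖z‖ ≤ R * (1 - s * q / 2) := by
    calc ‖z‖ ≤ ‖(1 - s) • x‖ + ‖(s * (1 - q / 2) * R) • u‖ := norm_add_le _ _
      _ = (1 - s) * ‖x‖ + s * (1 - q / 2) * R := by
        rw [norm_smul, norm_smul, hu, Real.norm_of_nonneg (by linarith), Real.norm_of_nonneg hb0,
          mul_one]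
      _ ≤ (1 - s) * R + s * (1 - q / 2) * R := by
        gcongr
      _ = _ := by ring
  have hsq : 0 < s * q := mul_pos hs0 hq0
  have hsq1 : s * q ≤ 1 := by nlinarith
  -- With `r = s q / 2`, `(1 - r)² ≤ 1 - r` and `R² r = 25 ε²`: the contraction frees `25 ε²` of
  -- squared norm.
  have hzn2 : ‖z‖ ^ 2 ≤ R ^ 2 - 25 * ε ^ 2 := by
    calc ‖z‖ ^ 2 ≤ (R * (1 - s * q / 2)) ^ 2 := by gcongr
      _ = R ^ 2 * (1 - s * q / 2) ^ 2 := by ring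
      _ ≤ R ^ 2 * (1 - s * q / 2) := by
        gcongr
        nlinarith
      _ = _ := by linear_combination (-1 / 2) * hsε
  have hzv : inner ℝ z v = (1 - s) * inner ℝ x v + s * (1 - q / 2) * R * inner ℝ u v := by
    simp only [hz, inner_add_left, real_inner_smul_left]
  have hsv : |(1 - s) * inner ℝ x v| ≤ ε := by
    rw [abs_mul, abs_of_nonneg (by linarith : 0 ≤ 1 - s)]
    have := abs_nonneg (inner ℝ x v)
    nlinarith
  have hbu0 : 0 ≤ s * (1 - q / 2) * R * inner ℝ u v := mul_nonneg hb0 huv'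
  have hbu1 : s * (1 - q / 2) * R * inner ℝ u v ≤ ε :=
    (mul_le_of_le_one_right hb0 huv1).trans hb1
  have hsv' := abs_le.1 hsv
  refine ⟨?_, ?_, ?_, ?_⟩
  · rw [hy]
    -- Since `⟨z, v⟩ ≤ 2ε`, the push adds at most `12 ε² + 9 ε²`, less than the `25 ε²` available.
    have : ‖z + (3 * ε) • v‖ ^ 2 < R ^ 2 := by
      rw [norm_add_sq_real, real_inner_smul_right, norm_smul, hv, Real.norm_of_nonneg (by positivity)]
      nlinarith
    exact lt_of_pow_lt_pow_left₀ 2 hR.le this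
  · have : inner ℝ ((1 - s) • x + w) u =
        (1 - s) * inner ℝ x u + (s * (1 - q / 2) * R + 3 * ε * inner ℝ v u) := by
      simp only [w, inner_add_left, real_inner_smul_left, huu]; ring
    rw [this]
    have h1 : 0 ≤ 3 * ε * inner ℝ v u := by positivity
    have h2 : 0 < s * (q / 2 * R) := by positivity
    have h3 : s * inner ℝ x u ≤ s * ((1 - q) * R) := by gcongr
    nlinarith
  · rw [hy, inner_add_left, real_inner_smul_left, hvv, hzv]
    linarith
  · have : (1 - s) • x + w - x = -(s • x) + (s * (1 - q / 2) * R) • u + (3 * ε) • v := by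
      simp only [w, sub_smul, one_smul]; abel
    rw [this]
    calc _ ≤ ‖-(s • x)‖ + ‖(s * (1 - q / 2) * R) • u‖ + ‖(3 * ε) • v‖ := norm_add₃_le
      _ = s * ‖x‖ + s * (1 - q / 2) * R + 3 * ε := by
        rw [norm_neg, norm_smul, norm_smul, norm_smul, hu, hv, Real.norm_of_nonneg hs0.le,
          Real.norm_of_nonneg hb0, Real.norm_of_nonneg (by positivity : 0 ≤ 3 * ε), mul_one, mul_one]
      _ ≤ s * R + ε + 3 * ε := by gcongr
      _ ≤ _ := by linarith

theorem volume_norm_arm_eq {K d : ℕ} (i : Fin K) {R : ℝ} (hR : 0 < R) :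
    (volume : Measure (Contexts K d)) {x | ‖x i‖ = R} = 0 := by
  have h := (Measure.quasiMeasurePreserving_eval
    (fun _ : Fin K => (volume : Measure (EuclideanSpace ℝ (Fin d)))) i).preimage_null
    (Measure.addHaar_sphere_of_ne_zero volume (0 : EuclideanSpace ℝ (Fin d)) hR.ne')
  rwa [show Function.eval i ⁻¹' Metric.sphere (0 : EuclideanSpace ℝ (Fin d)) R =
    {x : Contexts K d | ‖x i‖ = R} by ext x; simp] at h

theorem measurable_eval_arm {α E : Type*} [MeasurableSpace α] [MeasurableSpace E] {K : ℕ}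
    {a : α → Fin K} {g : α → Fin K → E} (ha : Measurable a) (hg : Measurable g) :
    Measurable fun ω => g ω (a ω) := by
  have h : Measurable fun p : (Fin K → E) × Fin K => p.1 p.2 :=
    measurable_from_prod_countable_left fun i => measurable_pi_apply i
  exact h.comp (hg.prodMk ha)

/-- The stability hypothesis `hstab` makes the push preserve the selected arm. The bad event can
thus be split by selected arm: on each piece the push is one injective affine map, and the images
lie in disjoint pieces of the target event. -/
theorem withDensity_le_two_mul_of_stable {K d : ℕ} {R L q s ε : ℝ} {f : Contexts K d → ℝ}
    (hf0 : ∀ x, 0 ≤ f x)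
    (hf : SatisfiesLAC (openBallProduct K d R) f (Polynomial.C L)) (hL : 0 ≤ L)
    {a : Contexts K d → Fin K} (ha : Measurable a) {u v : EuclideanSpace ℝ (Fin d)}
    (hstab : ∀ x y, inner ℝ (x (a x)) u < inner ℝ y u → a (Function.update x (a x) y) = a x)
    (hu : ‖u‖ = 1) (hv : ‖v‖ = 1) (huv : 0 ≤ inner ℝ v u)
    (hR : 0 < R) (hq0 : 0 < q) (hq1 : q < 1) (hs0 : 0 < s) (hs1 : s ≤ 1 / 2) (hε : 0 < ε)
    (hsR : s * R ≤ ε) (hsε : s * q * R ^ 2 = 50 * ε ^ 2) (hLε : L * √d * ε ≤ 1 / 50)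
    (hsd : s * d ≤ 1 / 50) :
    volume.withDensity (fun x => ENNReal.ofReal (f x))
        {x | (∀ i, ‖x i‖ ≤ R) ∧ inner ℝ (x (a x)) u ≤ (1 - q) * R ∧ |inner ℝ (x (a x)) v| < ε}
      ≤ 2 * volume.withDensity (fun x => ENNReal.ofReal (f x))
          {x | ε ≤ |inner ℝ (x (a x)) v|} := by
  set μ := (volume : Measure (Contexts K d)).withDensity (fun x => ENNReal.ofReal (f x)) with hμ
  set w := (s * (1 - q / 2) * R) • u + (3 * ε) • v with hw
  set T : Fin K → Contexts K d → Contexts K d := fun i => moveArm i (1 - s) w with hT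
  set B : Fin K → Set (Contexts K d) := fun i => {x | x ∈ openBallProduct K d R ∧ a x = i ∧
    inner ℝ (x (a x)) u ≤ (1 - q) * R ∧ |inner ℝ (x (a x)) v| < ε} with hBdef
  have hxa : Measurable fun x : Contexts K d => x (a x) := measurable_eval_arm ha measurable_id
  have hmA : MeasurableSet {x : Contexts K d | ε ≤ |inner ℝ (x (a x)) v|} :=
    measurableSet_le measurable_const (continuous_abs.measurable.comp (hxa.inner_const))
  have hmO : MeasurableSet (openBallProduct K d R) := by
    rw [openBallProduct_eq_pi]
    exact MeasurableSet.univ_pi fun _ => measurableSet_ball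
  have hmB : ∀ i, MeasurableSet (B i) := fun i =>
    hmO.inter <| (ha (measurableSet_singleton i)).inter <|
      MeasurableSet.inter (s₁ := {x : Contexts K d | inner ℝ (x (a x)) u ≤ (1 - q) * R})
        (s₂ := {x : Contexts K d | |inner ℝ (x (a x)) v| < ε})
        (measurableSet_le hxa.inner_const measurable_const)
        (measurableSet_lt (continuous_abs.measurable.comp hxa.inner_const) measurable_const)
  have hpush : ∀ i, ∀ x ∈ B i, T i x ∈ openBallProduct K d R ∧ a (T i x) = i ∧
      ε ≤ |inner ℝ (T i x (a (T i x))) v| ∧ ‖(1 - s) • x i + w - x i‖ ≤ 5 * ε := by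
    rintro i x ⟨hxO, rfl, hxu, hxv⟩
    obtain ⟨h1, h2, h3, h4⟩ := push_in_ball hu hv huv hR hq0 hq1 hs0 (by linarith) hε hsR hsε
      (hxO (a x)).le hxu hxv
    have haT : a (T (a x) x) = a x := hstab x _ h2
    refine ⟨?_, haT, ?_, h4⟩
    · intro j
      by_cases hj : j = a x
      · subst hj; simpa [hT, moveArm] using h1
      · simpa [hT, moveArm, hj] using hxO j
    · rw [haT]
      simp only [hT, moveArm, Function.update_self]
      exact h3.trans (le_abs_self _)
  have hdens : ∀ i, ∀ x ∈ B i, f x ≤ 2 * ((1 - s) ^ d * f (T i x)) := by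
    intro i x hx
    obtain ⟨h1, h2, h3, h4⟩ := hpush i x hx
    have hTx : T i x = x + Pi.single i ((1 - s) • x i + w - x i) := by
      funext j
      by_cases hj : j = i
      · subst hj; simp [hT, moveArm]
      · simp [hT, moveArm, hj]
    have h5 := hf.density_le i ((1 - s) • x i + w - x i) hx.1 (hTx ▸ h1)
    rw [← hTx] at h5
    have h6 : L * (√d * ‖(1 - s) • x i + w - x i‖) ≤ 1 / 10 := by
      calc _ ≤ L * (√d * (5 * ε)) := by gcongr
        _ = 5 * (L * √d * ε) := by ring
        _ ≤ _ := by linarith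
    -- Bernoulli's inequality; the total loss factor `49/50 · 9/10` exceeds `1/2`.
    have h7 : 1 - s * d ≤ (1 - s) ^ d := by
      have := one_add_mul_le_pow (a := -s) (by linarith) d
      rw [← sub_eq_add_neg] at this
      linarith
    have hfx := hf0 x
    have h8 : 9 / 10 * f x ≤ f (T i x) := by nlinarith
    have h9 : (49 / 50 : ℝ) ≤ (1 - s) ^ d := by linarith
    have : 49 / 50 * (9 / 10 * f x) ≤ (1 - s) ^ d * f (T i x) := by gcongr
    linarith
  have hBi : ∀ i, μ (B i) ≤ 2 * μ ({x | ε ≤ |inner ℝ (x (a x)) v|} ∩ a ⁻¹' {i}) := by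
    intro i
    calc μ (B i) = ∫⁻ x in B i, ENNReal.ofReal (f x) := withDensity_apply _ (hmB i)
      _ ≤ ∫⁻ x in B i, 2 * (ENNReal.ofReal ((1 - s) ^ d) * ENNReal.ofReal (f (T i x))) := by
        refine setLIntegral_mono' (hmB i) fun x hx => ?_
        rw [← ENNReal.ofReal_mul (by apply pow_nonneg; linarith),
          ← ENNReal.ofReal_ofNat 2, ← ENNReal.ofReal_mul zero_le_two]
        exact ENNReal.ofReal_le_ofReal (hdens i x hx)
      _ = 2 * ∫⁻ x in T i '' B i, ENNReal.ofReal (f x) := by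
        rw [lintegral_const_mul' _ _ (by simp),
          lintegral_image_moveArm i (by linarith : 0 < 1 - s) w (hmB i)]
      _ ≤ 2 * ∫⁻ x in {x | ε ≤ |inner ℝ (x (a x)) v|} ∩ a ⁻¹' {i}, ENNReal.ofReal (f x) := by
        gcongr
        rintro _ ⟨x, hx, rfl⟩
        obtain ⟨_, h2, h3, _⟩ := hpush i x hx
        exact ⟨h3, h2⟩
      _ = _ := by rw [hμ, withDensity_apply _ (hmA.inter (ha (measurableSet_singleton i)))]
  -- Anti-concentration is available only in the open domain, so boundary spheres are discarded as a
  -- null set.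
  have hnull : μ (⋃ i, {x : Contexts K d | ‖x i‖ = R}) = 0 :=
    withDensity_absolutelyContinuous _ _ (measure_iUnion_null fun i => volume_norm_arm_eq i hR)
  have hcover : {x : Contexts K d | (∀ i, ‖x i‖ ≤ R) ∧ inner ℝ (x (a x)) u ≤ (1 - q) * R ∧
      |inner ℝ (x (a x)) v| < ε} ⊆ (⋃ i, B i) ∪ ⋃ i, {x : Contexts K d | ‖x i‖ = R} := by
    rintro x ⟨h1, h2, h3⟩
    by_cases h : ∃ i, ‖x i‖ = R
    · exact Or.inr (Set.mem_iUnion.2 h)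
    · push Not at h
      exact Or.inl (Set.mem_iUnion.2 ⟨a x, fun i => lt_of_le_of_ne (h1 i) (h i), rfl, h2, h3⟩)
  calc _ ≤ μ (⋃ i, B i) + μ (⋃ i, {x : Contexts K d | ‖x i‖ = R}) :=
        (measure_mono hcover).trans (measure_union_le _ _)
    _ = μ (⋃ i, B i) := by rw [hnull, add_zero]
    _ ≤ ∑ i, μ (B i) := measure_iUnion_fintype_le _ _
    _ ≤ ∑ i, 2 * μ ({x | ε ≤ |inner ℝ (x (a x)) v|} ∩ a ⁻¹' {i}) :=
        Finset.sum_le_sum fun i _ => hBi i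
    _ = 2 * ∑ i, μ.restrict {x | ε ≤ |inner ℝ (x (a x)) v|} (a ⁻¹' {i}) := by
        rw [Finset.mul_sum]
        refine Finset.sum_congr rfl fun i _ => ?_
        rw [Measure.restrict_apply (ha (measurableSet_singleton i)), Set.inter_comm]
    _ = _ := by
        rw [sum_measure_preimage_singleton _ fun i _ => ha (measurableSet_singleton i)]
        simp

/-- The law of the selected context is spread out in the direction `v`. -/
theorem second_moment_ge_of_stable {K d : ℕ} (hd : 1 ≤ d) {R L cs ps : ℝ} {f : Contexts K d → ℝ}
    {μ : Measure (Contexts K d)} [IsProbabilityMeasure μ]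
    (hμ : μ = volume.withDensity (fun x => ENNReal.ofReal (f x)))
    (hf0 : ∀ x, 0 ≤ f x)
    (hf : SatisfiesLAC (openBallProduct K d R) f (Polynomial.C L))
    (hR : 0 < R) (hcs0 : 0 < cs) (hcs1 : cs < 1) (hps : 0 < ps)
    (hsupp : ∀ᵐ x ∂μ, ∀ i, ‖x i‖ ≤ R)
    {a : Contexts K d → Fin K} (ha : Measurable a) {u v : EuclideanSpace ℝ (Fin d)}
    (hstab : ∀ x y, inner ℝ (x (a x)) u < inner ℝ y u → a (Function.update x (a x) y) = a x)
    (hu : ‖u‖ = 1) (hv : ‖v‖ = 1) (huv : 0 ≤ inner ℝ v u)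
    (hconc : ps ≤ μ.real {x | ∀ i, inner ℝ (x i) u ≤ cs * R}) :
    1 / 7500 * (ps / d) * (1 / (L + 1 / (R * (1 - cs))) ^ 2)
      ≤ ∫ x, (inner ℝ (x (a x)) v) ^ 2 ∂μ := by
  have hKne : Nonempty (Fin K) := ⟨a 0⟩
  have hL : 0 ≤ L := by
    have h0 : (0 : Contexts K d) ∈ openBallProduct K d R := fun i => by simpa using hR
    have := hf.bound 0 h0 (a 0) ⟨0, hd⟩
    rw [Polynomial.eval_C] at this
    exact (abs_nonneg _).trans this
  have hd0 : (1 : ℝ) ≤ d := by exact_mod_cast hd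
  set q := 1 - cs with hq
  have hq0 : 0 < q := by linarith
  have hq1 : q < 1 := by linarith
  set D := L + 1 / (R * q) with hD
  have hRq : 0 < R * q := by positivity
  have hD0 : 0 < D := by positivity
  have hDR : 1 ≤ D * (R * q) := by
    rw [hD, add_mul, div_mul_cancel₀ _ hRq.ne']
    have : 0 ≤ L * (R * q) := by positivity
    linarith
  have hsd1 : 1 ≤ √(d : ℝ) := by rw [Real.one_le_sqrt]; exact hd0
  have hsd2 : √(d : ℝ) ^ 2 = d := Real.sq_sqrt (by linarith)
  -- The term `L` of `D` keeps the density loss `5 L √d ε` below `1/10`; the term `1/(R q)` gives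
  -- `50 √d ε ≤ R q`, hence `s d ≤ 1/50` and `s R ≤ ε`.
  set ε := 1 / (50 * (√d * D)) with hεdef
  have hε : 0 < ε := by positivity
  have hεD : 50 * (√d * D) * ε = 1 := by rw [hεdef]; field_simp
  have hεsd : 50 * (√d * ε) ≤ R * q := by
    have : 50 * (√d * ε) * D ≤ R * q * D := by linarith
    exact le_of_mul_le_mul_right this hD0
  have hε2 : 2500 * d * ε ^ 2 ≤ (R * q) ^ 2 := by
    calc 2500 * d * ε ^ 2 = (50 * (√d * ε)) ^ 2 := by rw [mul_pow, mul_pow, hsd2]; ring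
      _ ≤ _ := by gcongr
  set s := 50 * ε ^ 2 / (q * R ^ 2) with hs
  have hs0 : 0 < s := by positivity
  have hsε : s * q * R ^ 2 = 50 * ε ^ 2 := by rw [hs]; field_simp
  have hsd : s * d ≤ 1 / 50 := by
    have : s * d = 50 * d * ε ^ 2 / (q * R ^ 2) := by rw [hs]; ring
    rw [this, div_le_iff₀ (by positivity)]
    nlinarith [sq_nonneg R]
  have hs1 : s ≤ 1 / 2 := by nlinarith
  have hsR : s * R ≤ ε := by
    have : s * R = ε * (50 * ε / (q * R)) := by rw [hs]; field_simp
    rw [this]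
    refine mul_le_of_le_one_right hε.le ?_
    rw [div_le_one (by positivity)]
    nlinarith
  have hLε : L * √d * ε ≤ 1 / 50 := by
    have h1 : L ≤ D := by rw [hD]; linarith [one_div_pos.2 hRq]
    have : L * √d * ε ≤ D * √d * ε := by gcongr
    nlinarith
  have key := withDensity_le_two_mul_of_stable hf0 hf hL ha hstab hu hv huv hR hq0 hq1 hs0 hs1
    hε hsR hsε hLε hsd
  rw [← hμ] at key
  set A : Set (Contexts K d) := {x | ε ≤ |inner ℝ (x (a x)) v|} with hA
  set B : Set (Contexts K d) := {x | (∀ i, ‖x i‖ ≤ R) ∧ inner ℝ (x (a x)) u ≤ (1 - q) * R ∧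
    |inner ℝ (x (a x)) v| < ε} with hB
  have hxa : Measurable fun x : Contexts K d => x (a x) := measurable_eval_arm ha measurable_id
  have hmA : MeasurableSet A :=
    measurableSet_le measurable_const (continuous_abs.measurable.comp (hxa.inner_const))
  have key' : μ.real B ≤ 2 * μ.real A := by
    have := ENNReal.toReal_mono (by finiteness) key
    simpa [Measure.real] using this
  have hcover : μ.real {x | ∀ i, inner ℝ (x i) u ≤ cs * R} ≤ μ.real (A ∪ B) := by
    refine ENNReal.toReal_mono (by finiteness) (measure_mono_ae ?_)
    filter_upwards [hsupp] with x hx hxc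
    by_cases h : ε ≤ |inner ℝ (x (a x)) v|
    · exact Or.inl h
    · refine Or.inr ⟨hx, ?_, not_le.1 h⟩
      have : 1 - q = cs := by rw [hq]; ring
      rw [this]
      exact hxc (a x)
  -- `A ∪ B` has mass at least `ps`, and `B` at most twice that of `A`.
  have hpA : ps ≤ 3 * μ.real A := by
    have := measureReal_union_le (μ := μ) A B
    linarith
  have hint : Integrable (fun x : Contexts K d => (inner ℝ (x (a x)) v : ℝ) ^ 2) μ := by
    refine Integrable.of_bound (C := R ^ 2) ((hxa.inner_const).pow_const 2).aestronglyMeasurable ?_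
    filter_upwards [hsupp] with x hx
    rw [Real.norm_of_nonneg (sq_nonneg _), ← sq_abs]
    have := abs_real_inner_le_norm (x (a x)) v
    rw [hv, mul_one] at this
    gcongr
    exact this.trans (hx _)
  have hval : 1 / 7500 * (ps / d) * (1 / D ^ 2) = ε ^ 2 * (ps / 3) := by
    have : ε ^ 2 = 1 / (2500 * (d * D ^ 2)) := by
      rw [hεdef, div_pow, mul_pow, mul_pow, hsd2]; norm_num
    rw [this]
    field_simp
    norm_num
  rw [hval]
  calc ε ^ 2 * (ps / 3) ≤ ε ^ 2 * μ.real A := by gcongr; linarith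
    _ ≤ ε ^ 2 * μ.real {x | ε ^ 2 ≤ (inner ℝ (x (a x)) v) ^ 2} := by
      gcongr
      · exact measure_ne_top _ _
      · intro x hx
        have := pow_le_pow_left₀ hε.le hx 2
        rwa [sq_abs] at this
    _ ≤ _ := mul_meas_ge_le_integral_of_nonneg (ae_of_all _ fun x => sq_nonneg _) hint _

/-! ### Eigenvalues, and measurability of the greedy run. -/

/-- Turns the singularity test of the algorithm into a polynomial condition on the entries, whose
measurability is clear. -/
theorem minEigenvalue_eq_zero_iff {d : ℕ} (hd : 1 ≤ d) {A : Matrix (Fin d) (Fin d) ℝ}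
    (hA : A.PosSemidef) : minEigenvalue A = 0 ↔ A.det = 0 := by
  have hne : Nonempty (Fin d) := ⟨⟨0, hd⟩⟩
  rw [minEigenvalue, hA.1.spectrum_real_eq_range_eigenvalues, hA.1.det_eq_prod_eigenvalues,
    Finset.prod_eq_zero_iff]
  simp only [Finset.mem_univ, true_and, RCLike.ofReal_real_eq_id, id_eq]
  have hnonneg := hA.eigenvalues_nonneg
  constructor
  · intro h
    have := (Set.finite_range hA.1.eigenvalues).isCompact.sInf_mem (Set.range_nonempty _)
    rw [h] at this
    exact this
  · rintro ⟨i, hi⟩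
    refine le_antisymm ?_ (Real.sInf_nonneg ?_)
    · exact (csInf_le (Set.finite_range _).bddBelow ⟨i, rfl⟩).trans hi.le
    · rintro _ ⟨j, rfl⟩; exact hnonneg j

theorem le_minEigenvalue {d : ℕ} (hd : 1 ≤ d) {A : Matrix (Fin d) (Fin d) ℝ} {l : ℝ}
    (hA : (A - l • (1 : Matrix (Fin d) (Fin d) ℝ)).PosSemidef) : l ≤ minEigenvalue A := by
  have hne : Nonempty (Fin d) := ⟨⟨0, hd⟩⟩
  have hl : (l • (1 : Matrix (Fin d) (Fin d) ℝ)).IsHermitian := by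
    rw [IsHermitian, conjTranspose_smul]; simp
  have hH : A.IsHermitian := by
    have := hA.1.add hl
    rwa [sub_add_cancel] at this
  rw [minEigenvalue, hH.spectrum_real_eq_range_eigenvalues]
  refine le_csInf (Set.range_nonempty _) ?_
  rintro _ ⟨i, rfl⟩
  have h := hA.dotProduct_mulVec_nonneg (hH.eigenvectorBasis i).ofLp
  have h1 : star (hH.eigenvectorBasis i).ofLp ⬝ᵥ (hH.eigenvectorBasis i).ofLp = (1 : ℝ) := by
    have := real_inner_self_eq_norm_sq (hH.eigenvectorBasis i)
    rw [hH.eigenvectorBasis.norm_eq_one, EuclideanSpace.inner_eq_star_dotProduct] at this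
    simpa using this
  rw [sub_mulVec, hH.mulVec_eigenvectorBasis, smul_mulVec, one_mulVec, dotProduct_sub,
    dotProduct_smul, dotProduct_smul, h1] at h
  simpa using h

section Measurability

variable {α : Type*} [MeasurableSpace α] {d : ℕ}

theorem measurable_det {A : α → Matrix (Fin d) (Fin d) ℝ}
    (hA : ∀ j k, Measurable fun ω => A ω j k) : Measurable fun ω => (A ω).det := by
  simp only [det_apply]
  refine Finset.measurable_sum _ fun σ _ => Measurable.const_smul ?_ _
  exact Finset.measurable_prod _ fun j _ => hA _ _

theorem measurable_inv_apply {A : α → Matrix (Fin d) (Fin d) ℝ}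
    (hA : ∀ j k, Measurable fun ω => A ω j k) (j k : Fin d) :
    Measurable fun ω => (A ω)⁻¹ j k := by
  simp only [Matrix.inv_def, Ring.inverse_eq_inv', Matrix.smul_apply, smul_eq_mul, adjugate_apply]
  refine (measurable_det hA).inv.mul (measurable_det fun l m => ?_)
  simp only [updateRow_apply]
  split_ifs
  · exact measurable_const
  · exact hA _ _

theorem measurable_linGreedyParam (hd : 1 ≤ d) (θ₀ : EuclideanSpace ℝ (Fin d))
    {S : α → Matrix (Fin d) (Fin d) ℝ × EuclideanSpace ℝ (Fin d)}
    (hpsd : ∀ ω, (S ω).1.PosSemidef) (h1 : ∀ j k, Measurable fun ω => (S ω).1 j k)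
    (h2 : Measurable fun ω => (S ω).2) : Measurable fun ω => linGreedyParam θ₀ (S ω) := by
  have h : ∀ ω, linGreedyParam θ₀ (S ω) =
      if (S ω).1.det = 0 then θ₀ else WithLp.toLp 2 ((S ω).1⁻¹ *ᵥ (S ω).2.ofLp) := by
    intro ω
    simp only [linGreedyParam, minEigenvalue_eq_zero_iff hd (hpsd ω)]
  simp only [h]
  refine Measurable.ite (measurable_det h1 (measurableSet_singleton 0)) measurable_const ?_
  refine (WithLp.measurable_toLp 2 _).comp (measurable_pi_lambda _ fun j => ?_)
  simp only [mulVec, dotProduct]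
  refine Finset.measurable_sum _ fun k _ => (measurable_inv_apply h1 j k).mul ?_
  exact (measurable_pi_apply k).comp ((WithLp.measurable_ofLp 2 _).comp h2)

end Measurability

section Run

variable {Ω : Type*} {K d : ℕ} (sel : EuclideanSpace ℝ (Fin d) → Contexts K d → Fin K)
  (θs θ₀ : EuclideanSpace ℝ (Fin d)) (X : ℕ → Ω → Contexts K d) (η : ℕ → Ω → Fin K → ℝ)

/-- The parameter used by the greedy algorithm after `t` rounds. -/
noncomputable def greedyParam (t : ℕ) (ω : Ω) : EuclideanSpace ℝ (Fin d) :=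
  linGreedyParam θ₀ (linGreedyState sel θs θ₀ (fun s => X s ω) (fun s => η s ω) t)

theorem posSemidef_linGreedyState (t : ℕ) (ω : Ω) :
    (linGreedyState sel θs θ₀ (fun s => X s ω) (fun s => η s ω) t).1.PosSemidef := by
  induction t with
  | zero => exact PosSemidef.zero
  | succ t ih =>
    refine ih.add ?_
    exact posSemidef_vecMulVec_self_star _

/-- The sigma-algebra is left free: the ambient one serves to prove that the run is measurable, the
history one serves for conditioning. The state depends on the past only through pulled contexts and
rewards. -/
theorem measurable_greedyParam {m : MeasurableSpace Ω} (hd : 1 ≤ d) (t : ℕ)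
    (h : ∀ s ∈ Finset.Icc 1 t, Measurable (selectedContext sel θs θ₀ X η s) ∧
      Measurable (reward sel θs θ₀ X η s)) :
    Measurable (greedyParam sel θs θ₀ X η t) := by
  suffices H : (∀ j k, Measurable fun ω =>
      (linGreedyState sel θs θ₀ (fun s => X s ω) (fun s => η s ω) t).1 j k) ∧
      Measurable fun ω => (linGreedyState sel θs θ₀ (fun s => X s ω) (fun s => η s ω) t).2 from
    measurable_linGreedyParam hd θ₀ (posSemidef_linGreedyState sel θs θ₀ X η t) H.1 H.2
  induction t with
  | zero => exact ⟨fun _ _ => measurable_const, measurable_const⟩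
  | succ t ih =>
    obtain ⟨ih1, ih2⟩ := ih fun s hs => h s (by
      rw [Finset.mem_Icc] at hs ⊢; exact ⟨hs.1, hs.2.trans (Nat.le_succ t)⟩)
    obtain ⟨hc, hr⟩ := h (t + 1) (by simp)
    have hcj : ∀ j, Measurable fun ω => selectedContext sel θs θ₀ X η (t + 1) ω j := fun j =>
      (measurable_pi_apply j).comp ((WithLp.measurable_ofLp 2 _).comp hc)
    refine ⟨fun j k => (ih1 j k).add ((hcj j).mul (hcj k)), ih2.add (hr.smul hc)⟩

theorem measurable_selectedContext_reward [MeasurableSpace Ω] (hd : 1 ≤ d)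
    (hX : ∀ s, Measurable (X s)) (hη : ∀ s, Measurable (η s)) (hsel : IsGreedyRule sel) (t : ℕ) :
    1 ≤ t → Measurable (arm sel θs θ₀ X η t) ∧ Measurable (selectedContext sel θs θ₀ X η t) ∧
      Measurable (reward sel θs θ₀ X η t) := by
  induction t using Nat.strong_induction_on with
  | _ t ih =>
    intro ht
    have hp := measurable_greedyParam sel θs θ₀ X η hd (t - 1) fun s hs => by
      rw [Finset.mem_Icc] at hs
      exact (ih s (by omega) hs.1).2
    have ha : Measurable (arm sel θs θ₀ X η t) := hsel.measurable.comp (hp.prodMk (hX t))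
    have hc : Measurable (selectedContext sel θs θ₀ X η t) := measurable_eval_arm ha (hX t)
    exact ⟨ha, hc, hc.inner_const.add (measurable_eval_arm ha (hη t))⟩

theorem history_le [mΩ : MeasurableSpace Ω] (hd : 1 ≤ d)
    (hX : ∀ s, Measurable (X s)) (hη : ∀ s, Measurable (η s)) (hsel : IsGreedyRule sel) (t : ℕ) :
    history sel θs θ₀ X η t ≤ mΩ := by
  refine iSup₂_le fun s hs => ?_
  obtain ⟨h1, h2, h3⟩ := measurable_selectedContext_reward sel θs θ₀ X η hd hX hη hsel s
    (Finset.mem_Icc.1 hs).1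
  exact sup_le (sup_le h1.comap_le h2.comap_le) h3.comap_le

theorem measurable_greedyParam_history (hd : 1 ≤ d) (t : ℕ) :
    Measurable[history sel θs θ₀ X η t] (greedyParam sel θs θ₀ X η t) := by
  refine measurable_greedyParam (m := history sel θs θ₀ X η t) sel θs θ₀ X η hd t fun s hs => ?_
  have hle := le_iSup₂ (f := fun s (_ : s ∈ Finset.Icc 1 t) =>
    MeasurableSpace.comap (arm sel θs θ₀ X η s) inferInstance ⊔
    MeasurableSpace.comap (selectedContext sel θs θ₀ X η s) inferInstance ⊔
    MeasurableSpace.comap (reward sel θs θ₀ X η s) inferInstance) s hs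
  exact ⟨measurable_iff_comap_le.2 ((le_sup_right.trans le_sup_left).trans hle),
    measurable_iff_comap_le.2 (le_sup_right.trans hle)⟩

end Run

/-! ### Freezing a history-measurable parameter. -/

theorem measurable_prodMk_indicator_one {Ω α : Type*} {mΩ : MeasurableSpace Ω} [MeasurableSpace α]
    {Z : Ω → α} (hZ : Measurable Z) {s : Set Ω} (hs : MeasurableSet s) :
    Measurable fun ω => (Z ω, s.indicator (1 : Ω → ℝ) ω) :=
  hZ.prodMk (measurable_one.indicator hs)

/-- The conditional expectation of a function of an `m`-measurable and an independent variable. -/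
theorem condExp_ae_eq_integral_of_indep {Ω α β : Type*} {m mΩ : MeasurableSpace Ω}
    [MeasurableSpace α] [MeasurableSpace β] {P : Measure Ω} [IsProbabilityMeasure P] (hm : m ≤ mΩ)
    {Z : Ω → α} {Y : Ω → β} (hZ : Measurable[m] Z) (hY : Measurable Y)
    (hindep : Indep (MeasurableSpace.comap Y inferInstance) m P) {F : α → β → ℝ}
    (hF : Measurable (Function.uncurry F)) {C : ℝ} (hC : ∀ᵐ y ∂P.map Y, ∀ z, |F z y| ≤ C) :
    P[fun ω => F (Z ω) (Y ω) | m] =ᵐ[P] fun ω => ∫ y, F (Z ω) y ∂P.map Y := by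
  have hpY : IsProbabilityMeasure (P.map Y) := Measure.isProbabilityMeasure_map hY.aemeasurable
  have hZ' : Measurable Z := hZ.mono hm le_rfl
  have hCY : ∀ᵐ ω ∂P, ∀ z, |F z (Y ω)| ≤ C := ae_of_ae_map hY.aemeasurable hC
  have hG : StronglyMeasurable fun z => ∫ y, F z y ∂P.map Y :=
    StronglyMeasurable.integral_prod_right hF.stronglyMeasurable
  have hGb : ∀ z, ‖∫ y, F z y ∂P.map Y‖ ≤ C := by
    intro z
    have := norm_integral_le_of_norm_le_const (μ := P.map Y) (f := F z) (C := C)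
      (hC.mono fun y hy => hy z)
    simpa using this
  have hGi : Integrable (fun ω => ∫ y, F (Z ω) y ∂P.map Y) P :=
    Integrable.of_bound (hG.comp_measurable hZ').aestronglyMeasurable C
      (ae_of_all _ fun ω => hGb (Z ω))
  have hFi : Integrable (fun ω => F (Z ω) (Y ω)) P :=
    Integrable.of_bound (hF.comp (hZ'.prodMk hY)).aestronglyMeasurable C
      (hCY.mono fun ω h => h (Z ω))
  refine (ae_eq_condExp_of_forall_setIntegral_eq hm hFi (fun s _ _ => hGi.integrableOn) ?_
    (hG.comp_measurable hZ).aestronglyMeasurable).symm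
  intro s hs _
  -- Pairing `Z` with the indicator of the test set keeps an `m`-measurable variable, so `(W, Y)`
  -- has a product law and Fubini gives the set-integral identity.
  let W : Ω → α × ℝ := fun ω => (Z ω, s.indicator 1 ω)
  have hWm : Measurable[m] W := measurable_prodMk_indicator_one (mΩ := m) hZ hs
  have hW : Measurable W := hWm.mono hm le_rfl
  have hWY : IndepFun W Y P := by
    rw [IndepFun_iff_Indep]
    exact indep_of_indep_of_le_left hindep.symm hWm.comap_le
  rw [indepFun_iff_map_prod_eq_prod_map_map hW.aemeasurable hY.aemeasurable] at hWY
  have hpW : IsProbabilityMeasure (P.map W) := Measure.isProbabilityMeasure_map hW.aemeasurable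
  let H : (α × ℝ) × β → ℝ := fun p => p.1.2 * F p.1.1 p.2
  have hH : Measurable H := measurable_fst.snd.mul (hF.comp (measurable_fst.fst.prodMk measurable_snd))
  have hHW : ∀ G : Ω → ℝ, ∫ ω in s, G ω ∂P = ∫ ω, (W ω).2 * G ω ∂P := by
    intro G
    rw [← integral_indicator (hm s hs)]
    congr 1
    funext ω
    by_cases h : ω ∈ s <;> simp [W, h]
  have hHi : Integrable H ((P.map W).prod (P.map Y)) := by
    rw [← hWY, integrable_map_measure hH.aestronglyMeasurable (hW.prodMk hY).aemeasurable]
    refine Integrable.of_bound (hH.comp (hW.prodMk hY)).aestronglyMeasurable C ?_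
    filter_upwards [hCY] with ω h
    have h0 := (abs_nonneg _).trans (h (Z ω))
    by_cases hω : ω ∈ s
    · simpa [H, W, hω] using h (Z ω)
    · simpa [H, W, hω] using h0
  rw [hHW, hHW]
  calc ∫ ω, (W ω).2 * ∫ y, F (Z ω) y ∂P.map Y ∂P
      = ∫ ω, (fun p : α × ℝ => ∫ y, H (p, y) ∂P.map Y) (W ω) ∂P := by
        simp only [H, W, integral_const_mul]
    _ = ∫ p, ∫ y, H (p, y) ∂P.map Y ∂P.map W :=
        (integral_map hW.aemeasurable
          (hH.stronglyMeasurable.integral_prod_right').aestronglyMeasurable).symm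
    _ = ∫ p, H p ∂(P.map W).prod (P.map Y) := (integral_prod H hHi).symm
    _ = ∫ ω, H (W ω, Y ω) ∂P := by
        rw [← hWY, integral_map (hW.prodMk hY).aemeasurable hH.aestronglyMeasurable]
    _ = _ := rfl

/-! ### The matrix bound for every parameter, and conclusion. -/

/-- A strict improvement of the winning arm beats every competitor, whatever the tie-breaking. For
`θ = 0` the choice is constant and any unit vector serves. -/
theorem IsGreedyRule.exists_direction {K d : ℕ} (hd : 1 ≤ d)
    {sel : EuclideanSpace ℝ (Fin d) → Contexts K d → Fin K} (hsel : IsGreedyRule sel)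
    (θ : EuclideanSpace ℝ (Fin d)) : ∃ u : EuclideanSpace ℝ (Fin d), ‖u‖ = 1 ∧
      ∀ x y, inner ℝ (x (sel θ x)) u < inner ℝ y u →
        sel θ (Function.update x (sel θ x) y) = sel θ x := by
  by_cases hθ : θ = 0
  · subst hθ
    obtain ⟨i, hi⟩ := hsel.zero
    exact ⟨EuclideanSpace.single ⟨0, hd⟩ 1, by simp, fun x y _ => by rw [hi, hi]⟩
  · refine ⟨‖θ‖⁻¹ • θ, norm_smul_inv_norm hθ, fun x y h => ?_⟩
    rw [real_inner_smul_right, real_inner_smul_right] at h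
    have h' := lt_of_mul_lt_mul_left h (by positivity)
    by_contra hne
    have h1 := hsel.isMax θ (Function.update x (sel θ x) y) (sel θ x)
    rw [Function.update_self, Function.update_of_ne hne] at h1
    exact absurd (h'.trans_le (h1.trans (hsel.isMax θ x _))) (lt_irrefl _)

theorem posSemidef_selectedSecondMoment_sub {Ω : Type*} [MeasurableSpace Ω] {P : Measure Ω}
    [IsProbabilityMeasure P] {K d : ℕ} (hd : 1 ≤ d) {X : Ω → Contexts K d}
    {sel : EuclideanSpace ℝ (Fin d) → Contexts K d → Fin K} {f : Contexts K d → ℝ}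
    {R L cs ps : ℝ} (hX : Measurable X) (hsel : IsGreedyRule sel) (hR : 0 < R)
    (hXR : ∀ᵐ ω ∂P, ∀ i, ‖X ω i‖ ≤ R) (hdens : IsDensityOf P X f)
    (hf : SatisfiesLAC (openBallProduct K d R) f (Polynomial.C L))
    (hconc : HasConcentration P X R cs ps) (θ : EuclideanSpace ℝ (Fin d)) :
    (selectedSecondMoment P X sel θ - (1 / 7500 * (ps / d) * (1 / (L + 1 / (R * (1 - cs))) ^ 2)) •
      (1 : Matrix (Fin d) (Fin d) ℝ)).PosSemidef := by
  set l := 1 / 7500 * (ps / d) * (1 / (L + 1 / (R * (1 - cs))) ^ 2) with hl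
  obtain ⟨u, hu, hstab⟩ := hsel.exists_direction hd θ
  have ha : Measurable (sel θ) := hsel.measurable.comp (measurable_const.prodMk measurable_id)
  have hxa : Measurable fun x : Contexts K d => x (sel θ x) := measurable_eval_arm ha measurable_id
  have hXa : Measurable fun ω => X ω (sel θ (X ω)) := hxa.comp hX
  have hpX : IsProbabilityMeasure (P.map X) := Measure.isProbabilityMeasure_map hX.aemeasurable
  have hmR : MeasurableSet {x : Contexts K d | ∀ i, ‖x i‖ ≤ R} := by
    rw [Set.ofPred_forall]
    exact MeasurableSet.iInter fun i => measurableSet_le (measurable_pi_apply i).norm measurable_const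
  have hsupp : ∀ᵐ x ∂P.map X, ∀ i, ‖x i‖ ≤ R := (ae_map_iff hX.aemeasurable hmR).2 hXR
  have hconc' : ∀ u : EuclideanSpace ℝ (Fin d), ‖u‖ = 1 →
      ps ≤ (P.map X).real {x | ∀ i, inner ℝ (x i) u ≤ cs * R} := by
    intro u hu
    rw [map_measureReal_apply hX]
    · exact hconc.prob u hu
    · rw [Set.ofPred_forall]
      exact MeasurableSet.iInter fun i =>
        measurableSet_le (measurable_pi_apply i).inner_const measurable_const
  have hunit : ∀ v : EuclideanSpace ℝ (Fin d), ‖v‖ = 1 →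
      l ≤ ∫ ω, (inner ℝ (X ω (sel θ (X ω))) v) ^ 2 ∂P := by
    intro v hv
    rw [← integral_map (φ := X) (f := fun x => (inner ℝ (x (sel θ x)) v : ℝ) ^ 2) hX.aemeasurable
      (hxa.inner_const.pow_const 2).aestronglyMeasurable]
    -- The second moment is even in `v`, so its sign can be chosen.
    rcases le_total 0 (inner ℝ v u) with h | h
    · exact second_moment_ge_of_stable hd hdens.law hdens.nonneg hf hR
        hconc.cs_pos hconc.cs_lt_one hconc.ps_pos hsupp ha hstab hu hv h (hconc' u hu)
    · have := second_moment_ge_of_stable hd hdens.law hdens.nonneg hf hR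
        hconc.cs_pos hconc.cs_lt_one hconc.ps_pos hsupp ha hstab hu (v := -v) (by rwa [norm_neg])
        (by rw [inner_neg_left]; linarith) (hconc' u hu)
      simpa only [inner_neg_right, neg_sq] using this
  have hall : ∀ v : EuclideanSpace ℝ (Fin d),
      l * ‖v‖ ^ 2 ≤ ∫ ω, (inner ℝ (X ω (sel θ (X ω))) v) ^ 2 ∂P := by
    intro v
    by_cases hv : v = 0
    · simp [hv]
    · have hv0 : ‖v‖ ≠ 0 := norm_ne_zero_iff.2 hv
      have h := hunit (‖v‖⁻¹ • v) (norm_smul_inv_norm hv)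
      simp only [real_inner_smul_right, mul_pow, integral_const_mul] at h
      rw [inv_pow, ← div_eq_inv_mul, le_div_iff₀ (by positivity)] at h
      exact h
  have hcoord : ∀ j, Measurable fun ω => X ω (sel θ (X ω)) j := fun j =>
    (measurable_pi_apply j).comp ((WithLp.measurable_ofLp 2 _).comp hXa)
  have hint : ∀ j k, Integrable (fun ω => X ω (sel θ (X ω)) j * X ω (sel θ (X ω)) k) P := by
    intro j k
    refine Integrable.of_bound ((hcoord j).mul (hcoord k)).aestronglyMeasurable (R * R) ?_
    filter_upwards [hXR] with ω h
    rw [norm_mul]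
    have := fun j => (PiLp.norm_apply_le (X ω (sel θ (X ω))) j).trans (h _)
    gcongr <;> exact this _
  refine PosSemidef.of_dotProduct_mulVec_nonneg ?_ fun v => ?_
  · ext j k
    simp only [conjTranspose_apply, star_trivial, Matrix.sub_apply, Matrix.smul_apply,
      selectedSecondMoment, of_apply, Matrix.one_apply, eq_comm (a := j) (b := k)]
    congr 2
    funext ω
    exact mul_comm _ _
  · have hv := hall (WithLp.toLp 2 v)
    have h1 : star v ⬝ᵥ (selectedSecondMoment P X sel θ *ᵥ v) =
        ∫ ω, (inner ℝ (X ω (sel θ (X ω))) (WithLp.toLp 2 v)) ^ 2 ∂P := by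
      simp only [dotProduct, mulVec, selectedSecondMoment, of_apply, star_trivial]
      have : ∀ ω, (inner ℝ (X ω (sel θ (X ω))) (WithLp.toLp 2 v) : ℝ) ^ 2 =
          ∑ j, v j * ∑ k, X ω (sel θ (X ω)) j * X ω (sel θ (X ω)) k * v k := by
        intro ω
        rw [sq, PiLp.inner_apply, Finset.sum_mul]
        refine Finset.sum_congr rfl fun j _ => ?_
        rw [Finset.mul_sum, Finset.mul_sum]
        refine Finset.sum_congr rfl fun k _ => ?_
        simp
        ring
      simp only [this]
      rw [integral_finsetSum]
      · refine Finset.sum_congr rfl fun j _ => ?_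
        rw [integral_const_mul, integral_finsetSum]
        · simp only [integral_mul_const]
        · exact fun k _ => (hint j k).mul_const _
      · exact fun j _ => (integrable_finsetSum _ fun k _ => (hint j k).mul_const _).const_mul _
    have h2 : star v ⬝ᵥ v = ‖WithLp.toLp 2 v‖ ^ 2 := by
      rw [EuclideanSpace.real_norm_sq_eq]
      simp [dotProduct, sq]
    rw [sub_mulVec, smul_mulVec, one_mulVec, dotProduct_sub, dotProduct_smul, h1, h2, smul_eq_mul]
    linarith

end LACBandit

theorem mainTheorem5 :
    ∃ c : ℝ, 0 < c ∧
      ∀ (d K : ℕ) (_ : 1 ≤ d)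
        (Ω : Type*) [MeasurableSpace Ω] (P : MeasureTheory.Measure Ω)
        [MeasureTheory.IsProbabilityMeasure P]
        (X : ℕ → Ω → LACBandit.Contexts K d) (η : ℕ → Ω → Fin K → ℝ)
        (θs θ₀ : EuclideanSpace ℝ (Fin d))
        (sel : EuclideanSpace ℝ (Fin d) → LACBandit.Contexts K d → Fin K)
        (t : ℕ) (f : LACBandit.Contexts K d → ℝ) (R L cs ps : ℝ),
        (∀ s, Measurable (X s)) → (∀ s, Measurable (η s)) →
        LACBandit.IsGreedyRule sel →
        1 ≤ t → 0 < R →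
        (∀ᵐ ω ∂P, ∀ i, ‖X t ω i‖ ≤ R) →
        LACBandit.IsDensityOf P (X t) f →
        LACBandit.SatisfiesLAC (LACBandit.openBallProduct K d R) f (Polynomial.C L) →
        LACBandit.HasConcentration P (X t) R cs ps →
        c * (ps / d) * (1 / (L + 1 / (R * (1 - cs))) ^ 2)
            ≤ LACBandit.diversityConstant P (X t) sel ∧
        (ProbabilityTheory.Indep (MeasurableSpace.comap (X t) inferInstance)
            (LACBandit.history sel θs θ₀ X η (t - 1)) P →
          ∀ᵐ ω ∂P,
            (LACBandit.conditionalSecondMoment sel θs θ₀ X η P t ω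
              - (c * (ps / d) * (1 / (L + 1 / (R * (1 - cs))) ^ 2)) •
                (1 : Matrix (Fin d) (Fin d) ℝ)).PosSemidef) := by
  -- `7500 = 3 · 50²`, from the mass `ps / 3` and the constant `50` in `ε`.
  refine ⟨1 / 7500, by norm_num, ?_⟩
  intro d K hd Ω _ P _ X η θs θ₀ sel t f R L cs ps hX hη hsel ht hR hXR hdens hf hconc
  have hpsd := LACBandit.posSemidef_selectedSecondMoment_sub hd (hX t) hsel hR hXR hdens hf hconc
  refine ⟨?_, fun hindep => ?_⟩
  · have : Nonempty (Metric.sphere (0 : EuclideanSpace ℝ (Fin d)) 1) :=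
      ⟨⟨EuclideanSpace.single ⟨0, hd⟩ 1, by simp⟩⟩
    exact le_ciInf fun θ => LACBandit.le_minEigenvalue hd (hpsd θ)
  · have hm : ∀ j, Measurable fun p : EuclideanSpace ℝ (Fin d) × LACBandit.Contexts K d =>
        p.2 (sel p.1 p.2) j := fun j => (measurable_pi_apply j).comp
      ((WithLp.measurable_ofLp 2 _).comp
        (LACBandit.measurable_eval_arm hsel.measurable measurable_snd))
    have hmR : MeasurableSet {x : LACBandit.Contexts K d | ∀ i, ‖x i‖ ≤ R} := by
      rw [Set.ofPred_forall]
      exact MeasurableSet.iInter fun i =>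
        measurableSet_le (measurable_pi_apply i).norm measurable_const
    have hce : ∀ j k, ∀ᵐ ω ∂P, LACBandit.conditionalSecondMoment sel θs θ₀ X η P t ω j k =
        LACBandit.selectedSecondMoment P (X t) sel
          (LACBandit.greedyParam sel θs θ₀ X η (t - 1) ω) j k := by
      intro j k
      have h := LACBandit.condExp_ae_eq_integral_of_indep
        (LACBandit.history_le sel θs θ₀ X η hd hX hη hsel (t - 1))
        (LACBandit.measurable_greedyParam_history sel θs θ₀ X η hd (t - 1)) (hX t) hindep
        (F := fun θ x => x (sel θ x) j * x (sel θ x) k) ((hm j).mul (hm k)) (C := R * R) (by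
          rw [← ae_map_iff (hX t).aemeasurable hmR] at hXR
          filter_upwards [hXR] with x hx θ
          rw [abs_mul]
          have := fun j => (PiLp.norm_apply_le (x (sel θ x)) j).trans (hx _)
          gcongr <;> exact this _)
      filter_upwards [h] with ω hω
      refine hω.trans ?_
      rw [integral_map (hX t).aemeasurable]
      · rfl
      · exact (((hm j).mul (hm k)).comp (measurable_const.prodMk measurable_id)).aestronglyMeasurable
    have hce' : ∀ᵐ ω ∂P, ∀ j k, LACBandit.conditionalSecondMoment sel θs θ₀ X η P t ω j k =
        LACBandit.selectedSecondMoment P (X t) sel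
          (LACBandit.greedyParam sel θs θ₀ X η (t - 1) ω) j k :=
      ae_all_iff.2 fun j => ae_all_iff.2 fun k => hce j k
    filter_upwards [hce'] with ω hω
    rw [show LACBandit.conditionalSecondMoment sel θs θ₀ X η P t ω = _ from
      Matrix.ext fun j k => hω j k]
    -- The realised parameter may be any vector, zero included, hence a bound for all `θ` and not
    -- only unit vectors.
    exact hpsd _
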